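/- Let $g\in\mathbb{Q}[x,y]$ be a square-free polynomial with $\deg_y g\ge 1$. Let $M$ be the maximal real root of $\mathrm{lc}_y(g)\cdot\mathrm{discrim}_y(g)\in\mathbb{Q}[x]$ (the leading coefficient and the discriminant of $g$ with respect to $y$), with $M=-\infty$ if there is no real root; $M$ is called the start-point. Let $\theta_1<\cdots<\theta_r$ ($r\ge 0$) be the terminal-root-functions of $g$, i.e. the analytic functions on $(M,+\infty)$ such that for every $x_0\in(M,+\infty)$ the numbers $\theta_1(x_0)<\cdots<\theta_r(x_0)$ are exactly the real roots of $g(x_0,y)$. Let $\delta_0\in\mathbb{Q}$ be such that $$R:=\mathrm{Res}_y\!\left(\frac{\partial g}{\partial x}+\delta_0\frac{\partial g}{\partial y},\,g\right)\in\mathbb{Q}[x]$$ is not the zero polynomial, and let $\hat k\in\mathbb{N}$ (where $0\in\mathbb{N}$) be such that $\hat M=(\hat k+\tfrac12)\pi$ is an upper bound of $M$ and of all real roots of $R$. Then for each $i$ ($1\le i\le r$) one of the following holds: 1. $\theta_i'(x)<\delta_0$ for all $x>\hat M$; 2. $\theta_i'(x)>\delta_0$ for all $x>\hat M$. In particular,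 if $\delta_0<1$ and property 1 holds for some $\theta_i$, then for every $k\in\mathbb{N}$ with $k>\hat k$ there is a unique $\xi\in(k\pi-\tfrac{\pi}{2},\,k\pi+\tfrac{\pi}{2})$ such that $\theta_i(\xi)=\tan\xi$. -/

import Mathlib

open Polynomial

/- Polynomials `g ∈ ℚ[x, y]` are elements of `ℚ[X][Y]`, i.e. polynomials in the outer variable `y`
with coefficients in `ℚ[x]`. So `g.natDegree`, `g.leadingCoeff`, `g.discr`, `g.derivative` and
`Polynomial.resultant` are the degree, leading coefficient, discriminant, partial derivative and
resultant with respect to `y`. -/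

/-- The partial derivative `∂g/∂x`: differentiate every coefficient (a polynomial in `x`). -/
noncomputable def partialX (g : ℚ[X][X]) : ℚ[X][X] :=
  g.sum fun i c => monomial i (derivative c)

/-- The partial derivative `∂g/∂y`. -/
noncomputable def partialY (g : ℚ[X][X]) : ℚ[X][X] :=
  derivative g

/-- The polynomial `Res_y(∂g/∂x + δ₀ ∂g/∂y, g) ∈ ℚ[x]`. -/
noncomputable def slopeResultant (g : ℚ[X][X]) (δ₀ : ℚ) : ℚ[X] :=
  resultant (partialX g + C (C δ₀) * partialY g) g

/-- The start-point of the terminal-root-functions of `g`: the maximal real root of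
`lc(g, y) · discrim(g, y) ∈ ℚ[x]`, read as `⊥` (that is, `-∞`) if there is no real root. -/
noncomputable def startPoint (g : ℚ[X][X]) : WithBot ℝ :=
  ((g.leadingCoeff * g.discr).aroots ℝ).toFinset.max

/-- `θ 0 < ⋯ < θ (r - 1)` are the terminal-root-functions of `g`: they are analytic on `(M, ∞)`,
where `M` is the start-point, and for each `x₀ ∈ (M, ∞)` the numbers
`θ 0 x₀ < ⋯ < θ (r - 1) x₀` are exactly the real roots of `g(x₀, y)`.
(The values of `θ i` outside `(M, ∞)` are irrelevant.) -/
structure IsTerminalRootFunctions (g : ℚ[X][X]) {r : ℕ} (θ : Fin r → ℝ → ℝ) : Prop where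
  analytic : ∀ i, AnalyticOnNhd ℝ (θ i) {x : ℝ | startPoint g < (x : WithBot ℝ)}
  strictMono : ∀ x : ℝ, startPoint g < (x : WithBot ℝ) → StrictMono fun i => θ i x
  root_iff : ∀ x : ℝ, startPoint g < (x : WithBot ℝ) →
    ∀ y : ℝ, aevalAeval x y g = 0 ↔ ∃ i, y = θ i x

/-! Differentiating `g(x, θ i x) = 0` gives `∂g/∂x + (θ i)' ∂g/∂y = 0` along the curve. If `(θ i)' =
δ₀` at some `x`, this is a common zero with `g`, so `x` is a root of the resultant, impossible
beyond `Mhat`. By Darboux's theorem `(θ i)' - δ₀` then keeps one sign. If the slope is below `1 ≤ 1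
/ cos²`, `tan - θ i` increases strictly on each branch and changes sign there. -/

theorem partialX_add (p q : ℚ[X][X]) : partialX (p + q) = partialX p + partialX q :=
  sum_add_index p q _ (by simp) (by simp)

theorem partialX_monomial (n : ℕ) (c : ℚ[X]) :
    partialX (monomial n c) = monomial n (derivative c) :=
  sum_monomial_index c _ (by simp)

/-- The chain rule for `t ↦ g(t, f t)`. -/
theorem hasDerivAt_aevalAeval (g : ℚ[X][X]) {f : ℝ → ℝ} {f' x : ℝ} (hf : HasDerivAt f f' x) :
    HasDerivAt (fun t => aevalAeval t (f t) g)
      (aevalAeval x (f x) (partialX g) + f' * aevalAeval x (f x) (partialY g)) x := by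
  induction g using Polynomial.induction_on' with
  | add p q hp hq =>
    simp only [partialX_add, partialY, map_add] at hp hq ⊢
    exact (hp.add hq).congr_deriv (by ring)
  | monomial n c =>
    rw [partialX_monomial, partialY, derivative_monomial]
    simp only [← C_mul_X_pow_eq_monomial, map_mul, map_pow, aevalAeval_C, aevalAeval_Y, map_natCast]
    exact ((c.hasDerivAt_aeval x).mul (hf.pow n)).congr_deriv (by simp only [Pi.pow_apply]; ring)

/-- A common zero of `∂g/∂x + δ₀ ∂g/∂y` and `g` lies above a root of their resultant. -/
theorem aeval_slopeResultant_eq_zero {g : ℚ[X][X]} (hdeg : 1 ≤ g.natDegree) {δ₀ : ℚ} {x y : ℝ}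
    (h : aevalAeval x y (partialX g) + δ₀ * aevalAeval x y (partialY g) = 0)
    (hg : aevalAeval x y g = 0) : aeval x (slopeResultant g δ₀) = 0 := by
  obtain ⟨p, q, -, -, hpq⟩ := exists_mul_add_mul_eq_C_resultant
    (partialX g + C (C δ₀) * partialY g) g le_rfl le_rfl (Or.inr (by omega))
  have hev := congrArg (aevalAeval x y) hpq
  rw [aevalAeval_C, map_add, map_mul, map_mul, hg, map_add, map_mul, aevalAeval_C, aeval_C] at hev
  rw [slopeResultant, ← hev]
  simp only [eq_ratCast, h]
  ring

/-- A function on a branch `(kπ - π/2, kπ + π/2)` of the tangent with derivative less than `1`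
meets the graph of the tangent exactly once on that branch. -/
theorem existsUnique_eq_tan {f : ℝ → ℝ} (k : ℕ)
    (hf : ∀ x ∈ Set.Ioo (k * Real.pi - Real.pi / 2) (k * Real.pi + Real.pi / 2),
      DifferentiableAt ℝ f x ∧ deriv f x < 1) :
    ∃! ξ : ℝ, ξ ∈ Set.Ioo (k * Real.pi - Real.pi / 2) (k * Real.pi + Real.pi / 2) ∧
      f ξ = Real.tan ξ := by
  set I := Set.Ioo (k * Real.pi - Real.pi / 2) (k * Real.pi + Real.pi / 2) with hI
  have hpi := Real.pi_pos
  have hcos : ∀ x ∈ I, Real.cos x ≠ 0 := by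
    intro x hx h0
    have hpos : 0 < Real.cos (x - k * Real.pi) :=
      Real.cos_pos_of_mem_Ioo ⟨by linarith [hx.1], by linarith [hx.2]⟩
    rw [Real.cos_sub_nat_mul_pi, h0, mul_zero] at hpos
    exact hpos.false
  have hd : ∀ x ∈ I, HasDerivAt (fun t => Real.tan t - f t)
      (1 / Real.cos x ^ 2 - deriv f x) x := fun x hx =>
    (Real.hasDerivAt_tan (hcos x hx)).sub (hf x hx).1.hasDerivAt
  have hcont : ContinuousOn (fun t => Real.tan t - f t) I := fun x hx =>
    (hd x hx).continuousAt.continuousWithinAt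
  have hmono : StrictMonoOn (fun t => Real.tan t - f t) I := by
    refine strictMonoOn_of_deriv_pos (convex_Ioo _ _) hcont fun x hx => ?_
    rw [interior_Ioo] at hx
    rw [(hd x hx).deriv]
    have h1 : 1 ≤ 1 / Real.cos x ^ 2 :=
      one_le_one_div (by have := hcos x hx; positivity) (Real.cos_sq_le_one x)
    linarith [(hf x hx).2]
  -- Nothing is assumed about `f` at the ends of the branch. The slope bound alone gives `f > f(kπ)
  -- - π/2` left of `kπ` and `f < f(kπ) + π/2` right of it.
  have hanti : StrictAntiOn (fun t => f t - t) I := by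
    have hd' : ∀ x ∈ I, HasDerivAt (fun t => f t - t) (deriv f x - 1) x := fun x hx =>
      (hf x hx).1.hasDerivAt.sub (hasDerivAt_id x)
    refine strictAntiOn_of_deriv_neg (convex_Ioo _ _)
      (fun x hx => (hd' x hx).continuousAt.continuousWithinAt) fun x hx => ?_
    rw [interior_Ioo] at hx
    rw [(hd' x hx).deriv]
    linarith [(hf x hx).2]
  have hmem : ∀ c : ℝ, k * Real.pi + Real.arctan c ∈ I := fun c =>
    ⟨by linarith [Real.neg_pi_div_two_lt_arctan c], by linarith [Real.arctan_lt_pi_div_two c]⟩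
  have htan : ∀ c : ℝ, Real.tan (k * Real.pi + Real.arctan c) = c := fun c => by
    rw [add_comm, Real.tan_add_nat_mul_pi, Real.tan_arctan]
  have hmid : (k * Real.pi : ℝ) ∈ I := ⟨by linarith, by linarith⟩
  obtain ⟨a, ha, ha'⟩ : ∃ a ∈ I, Real.tan a - f a ≤ 0 := by
    -- The tangent equals `c` at `kπ + arctan c`; the `min` with `0` keeps this point in the left
    -- half.
    let c := min 0 (f (k * Real.pi) - Real.pi / 2)
    have hc : Real.arctan c ≤ 0 := by simp [c]
    refine ⟨_, hmem c, ?_⟩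
    have := hanti.antitoneOn (hmem c) hmid (by linarith)
    have hc' : c ≤ f (k * Real.pi) - Real.pi / 2 := min_le_right _ _
    rw [htan]
    linarith [Real.neg_pi_div_two_lt_arctan c]
  obtain ⟨b, hb, hb'⟩ : ∃ b ∈ I, 0 ≤ Real.tan b - f b := by
    let c := max 0 (f (k * Real.pi) + Real.pi / 2)
    have hc : 0 ≤ Real.arctan c := by simp [c]
    refine ⟨_, hmem c, ?_⟩
    have := hanti.antitoneOn hmid (hmem c) (by linarith)
    have hc' : f (k * Real.pi) + Real.pi / 2 ≤ c := le_max_right _ _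
    rw [htan]
    linarith [Real.arctan_lt_pi_div_two c]
  obtain ⟨ξ, hξ, hξ'⟩ := isPreconnected_Ioo.intermediate_value ha hb hcont ⟨ha', hb'⟩
  refine ⟨ξ, ⟨hξ, (sub_eq_zero.mp hξ').symm⟩, fun η ⟨hη, hη'⟩ => hmono.injOn hη hξ ?_⟩
  simp only at hξ' ⊢
  rw [hξ', hη', sub_self]

theorem lemma3p2 (g : ℚ[X][X]) (hg : Squarefree g) (hdeg : 1 ≤ g.natDegree)
    (δ₀ : ℚ) (hres : slopeResultant g δ₀ ≠ 0)
    {r : ℕ} (θ : Fin r → ℝ → ℝ) (hθ : IsTerminalRootFunctions g θ)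
    (khat : ℕ) (Mhat : ℝ) (hMhat : Mhat = ((khat : ℝ) + 1 / 2) * Real.pi)
    (hstart : startPoint g ≤ (Mhat : WithBot ℝ))
    (hroots : ∀ ρ : ℝ, aeval ρ (slopeResultant g δ₀) = 0 → ρ ≤ Mhat) :
    (∀ i : Fin r,
      (∀ x : ℝ, Mhat < x → deriv (θ i) x < δ₀) ∨ (∀ x : ℝ, Mhat < x → (δ₀ : ℝ) < deriv (θ i) x)) ∧
    (∀ i : Fin r, δ₀ < 1 → (∀ x : ℝ, Mhat < x → deriv (θ i) x < δ₀) →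
      ∀ k : ℕ, khat < k →
        ∃! ξ : ℝ, ξ ∈ Set.Ioo (k * Real.pi - Real.pi / 2) (k * Real.pi + Real.pi / 2) ∧
          θ i ξ = Real.tan ξ) := by
  have hlt : ∀ x : ℝ, Mhat < x → startPoint g < (x : WithBot ℝ) := fun x hx =>
    hstart.trans_lt (WithBot.coe_lt_coe.mpr hx)
  have hdiff : ∀ i, ∀ x : ℝ, Mhat < x → DifferentiableAt ℝ (θ i) x := fun i x hx =>
    (hθ.analytic i x (hlt x hx)).differentiableAt
  have hzero : ∀ i, ∀ x : ℝ, Mhat < x → aevalAeval x (θ i x) g = 0 := fun i x hx =>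
    (hθ.root_iff x (hlt x hx) _).mpr ⟨i, rfl⟩
  refine ⟨fun i => ?_, fun i hδ hslope k hk => ?_⟩
  · refine hasDerivWithinAt_forall_lt_or_forall_gt_of_forall_ne (convex_Ioi Mhat)
      (fun x hx => (hdiff i x hx).hasDerivAt.hasDerivWithinAt) fun x hx hxδ => ?_
    have hconst : (fun t => aevalAeval t (θ i t) g) =ᶠ[nhds x] fun _ => (0 : ℝ) := by
      filter_upwards [Ioi_mem_nhds hx] with t ht using hzero i t ht
    have hchain := (hasDerivAt_aevalAeval g (hdiff i x hx).hasDerivAt).unique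
      ((hasDerivAt_const x (0 : ℝ)).congr_of_eventuallyEq hconst)
    rw [hxδ] at hchain
    exact (hroots x (aeval_slopeResultant_eq_zero hdeg hchain (hzero i x hx))).not_gt hx
  · refine existsUnique_eq_tan k fun x hx => ?_
    have hk' : (khat : ℝ) + 1 ≤ k := by exact_mod_cast hk
    -- For `k = khat + 1` the left end of the branch is exactly `Mhat`.
    have hMx : Mhat < x := by
      have := mul_le_mul_of_nonneg_right hk' Real.pi_pos.le
      linarith [hx.1]
    exact ⟨hdiff i x hMx, (hslope x hMx).trans (by exact_mod_cast hδ)⟩
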